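/- \textbf{Conventions.} Graphs are simple, non-empty and possibly infinite. Every edge has length $1$, and a graph $G$ is regarded as a metric graph: its points are the vertices and the points of the edges, and $d_G(x,y)$ is the length of a shortest path from $x$ to $y$ ($\infty$ if $x,y$ lie in different connected components). A geodesic triangle is the union of three geodesics $[x_1x_2]$, $[x_2x_3]$, $[x_3x_1]$; it is $\delta$-thin if each side lies in the $\delta$-neighborhood of the union of the other two. $G$ is hyperbolic if, for some $\delta\ge 0$, every geodesic triangle in (any connected component of) $G$ is $\delta$-thin. $G$ is bounded if its diameter is finite, and non-trivial if it has more than one vertex. The direct product $G_1\times G_2$ has vertex set $V(G_1)\times V(G_2)$, and $(u_1,v_1)$, $(u_2,v_2)$ are adjacent if and only if $u_1,u_2$ are adjacent in $G_1$ and $v_1,v_2$ are adjacent in $G_2$. The odd girth $g_I(G)$ is the length of a shortest odd cycle of $G$. For $\alpha\ge1$ and $\beta,\varepsilon\ge0$, a map $f:X\to Y$ is an $(\alpha,\beta)$-quasi-isometric embedding if $\alpha^{-1}d_X(x,y)-\beta\le d_Y(f(x),f(y))\le\alpha d_X(x,y)+\beta$ for all $x,y\in X$, and it is $\varepsilon$-full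 if every $y\in Y$ is at distance at most $\varepsilon$ from some $f(x)$. \textbf{Theorem.} Let $G_1$ be a connected graph and let $G_2$ be a connected non-trivial bounded graph with some odd cycle. Then $G_1\times G_2$ is hyperbolic if and only if $G_1$ is hyperbolic. Moreover, if $G_1$ is non-trivial, then for every vertex $v_0$ of $G_2$ that lies on an odd cycle of length $g_I(G_2)$, the map $V(G_1)\to V(G_1\times G_2)$, $w\mapsto(w,v_0)$, is a quasi-isometry (for the distances $d_{G_1}$ and $d_{G_1\times G_2}$ restricted to vertices); more precisely, it is a $(1,g_I(G_2))$-quasi-isometric embedding and is $(\operatorname{diam}V(G_2)+g_I(G_2))$-full. -/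

import Mathlib

open scoped ENNReal NNReal

universe u v

namespace SimpleGraph

variable {V : Type u} {W : Type v}

/-- The direct product of two graphs: `(a, b)` and `(a', b')` are adjacent if and only if
`a, a'` are adjacent in `G` and `b, b'` are adjacent in `H`. -/
def directProd (G : SimpleGraph V) (H : SimpleGraph W) : SimpleGraph (V × W) where
  Adj p q := G.Adj p.1 q.1 ∧ H.Adj p.2 q.2
  symm := ⟨fun _ _ h => ⟨h.1.symm, h.2.symm⟩⟩
  loopless := ⟨fun _ h => G.irrefl h.1⟩

/-- `n` is the length of an odd cycle of `G` through the vertex `a`. -/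
def IsOddCycleLengthAt (G : SimpleGraph V) (a : V) (n : ℕ) : Prop :=
  ∃ c : G.Walk a a, c.IsCycle ∧ Odd c.length ∧ c.length = n

/-- `G` has an odd cycle. -/
def HasOddCycle (G : SimpleGraph V) : Prop :=
  ∃ a n, G.IsOddCycleLengthAt a n

/-- The odd girth: the length of a shortest odd cycle (`0` if there is no odd cycle). -/
noncomputable def oddGirth (G : SimpleGraph V) : ℕ :=
  sInf {n | ∃ a, G.IsOddCycleLengthAt a n}

/-- The metric graph (geometric realization) of `G`, in barycentric coordinates: its points are
the vertices `a` (that is, `single a 1`) and the points `(1 - t) a + t b`, `0 ≤ t ≤ 1`, of the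
edges `[a, b]`. -/
def MetricGraph (G : SimpleGraph V) : Type u :=
  {x : V →₀ ℝ // ∃ a b, (a = b ∨ G.Adj a b) ∧ ∃ t ∈ Set.Icc (0 : ℝ) 1,
    x = Finsupp.single a (1 - t) + Finsupp.single b t}

namespace MetricGraph

variable {G : SimpleGraph V}

/-- The barycentric coordinate of a point with respect to a vertex. -/
def coord (x : G.MetricGraph) (a : V) : ℝ := x.1 a

/-- The vertex `a` as a point of the metric graph. -/
noncomputable def vertex (G : SimpleGraph V) (a : V) : G.MetricGraph :=
  ⟨Finsupp.single a 1, a, a, Or.inl rfl, 0, by simp, by simp⟩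

/-- The point `x` lies on the closed edge `[a, b]` (on the vertex `a`, when `a = b`). -/
def LiesOn (x : G.MetricGraph) (a b : V) : Prop :=
  (a = b ∨ G.Adj a b) ∧ ∀ w, x.coord w ≠ 0 → w = a ∨ w = b

/-- The length of the segment between `x` and `y` inside a common closed edge, where edges have
length `1` (`∞` if `x` and `y` do not lie on a common closed edge). -/
noncomputable def edgeDist (x y : G.MetricGraph) : ℝ≥0∞ :=
  ⨅ (a : V) (b : V) (_ : x.LiesOn a b ∧ y.LiesOn a b), ENNReal.ofReal |x.coord a - y.coord a|

/-- The infimum of the lengths of the paths which go from `x` along its edge to an end `a` of this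
edge (a segment of length `1 - x.coord a`), then along edges of `G` to a vertex `b`, an end of the
edge of `y`, and from there along this edge to `y`. -/
noncomputable def vertexDist (x y : G.MetricGraph) : ℝ≥0∞ :=
  ⨅ (a : V) (b : V) (_ : x.coord a ≠ 0 ∧ y.coord b ≠ 0),
    ENNReal.ofReal (1 - x.coord a) + (G.edist a b : ℝ≥0∞) + ENNReal.ofReal (1 - y.coord b)

/-- The length of a shortest path from `x` to `y` in the metric graph
(`∞` if `x` and `y` lie in different connected components). -/
noncomputable def pathDist (x y : G.MetricGraph) : ℝ≥0∞ := min (edgeDist x y) (vertexDist x y)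

lemma coord_nonneg (x : G.MetricGraph) (a : V) : 0 ≤ x.coord a := by
  classical
  obtain ⟨x, b, c, h, t, ht, rfl⟩ := x
  simp only [coord, Finsupp.add_apply, Finsupp.single_apply]
  have := ht.1
  have := ht.2
  split_ifs <;> linarith

lemma exists_liesOn (x : G.MetricGraph) : ∃ a b, x.LiesOn a b := by
  classical
  obtain ⟨x, b, c, h, t, ht, rfl⟩ := x
  refine ⟨b, c, h, fun w hw => ?_⟩
  by_contra! hne
  apply hw
  simp [coord, hne.1, hne.2]

lemma sum_coord (x : G.MetricGraph) : x.1.sum (fun _ r => r) = 1 := by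
  obtain ⟨x, b, c, h, t, ht, rfl⟩ := x
  simp only
  rw [Finsupp.sum_add_index' (fun _ => rfl) (fun _ _ _ => rfl), Finsupp.sum_single_index rfl,
    Finsupp.sum_single_index rfl]
  ring

lemma coord_add {x : G.MetricGraph} {a b : V} (h : x.LiesOn a b) (hab : a ≠ b) :
    x.coord a + x.coord b = 1 := by
  classical
  rw [← sum_coord x, Finsupp.sum_of_support_subset (s := {a, b})]
  · rw [Finset.sum_pair hab]; rfl
  · intro w hw
    have := h.2 w (by simpa [coord] using hw)
    simpa using this
  · simp

lemma coord_self {x : G.MetricGraph} {a : V} (h : x.LiesOn a a) : x.coord a = 1 := by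
  classical
  rw [← sum_coord x, Finsupp.sum_of_support_subset (s := {a})]
  · rw [Finset.sum_singleton]; rfl
  · intro w hw
    have := h.2 w (by simpa [coord] using hw)
    simpa using this
  · simp

lemma LiesOn.swap {x : G.MetricGraph} {a b : V} (h : x.LiesOn a b) : x.LiesOn b a :=
  ⟨h.1.imp Eq.symm fun h' => h'.symm, fun w hw => (h.2 w hw).symm⟩

lemma abs_coord_sub_eq {x y : G.MetricGraph} {a b : V} (hx : x.LiesOn a b) (hy : y.LiesOn a b) :
    |x.coord a - y.coord a| = |x.coord b - y.coord b| := by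
  by_cases hab : a = b
  · rw [hab]
  · have h1 := coord_add hx hab
    have h2 := coord_add hy hab
    rw [abs_sub_comm]
    congr 1
    linarith

lemma pathDist_le_edge {x y : G.MetricGraph} {a b : V} (hx : x.LiesOn a b) (hy : y.LiesOn a b) :
    pathDist x y ≤ ENNReal.ofReal |x.coord a - y.coord a| :=
  (min_le_left _ _).trans (iInf_le_of_le a (iInf_le_of_le b (iInf_le _ ⟨hx, hy⟩)))

lemma pathDist_le_vertex {x y : G.MetricGraph} {a b : V} (hx : x.coord a ≠ 0)
    (hy : y.coord b ≠ 0) :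
    pathDist x y ≤
      ENNReal.ofReal (1 - x.coord a) + (G.edist a b : ℝ≥0∞) + ENNReal.ofReal (1 - y.coord b) :=
  (min_le_right _ _).trans (iInf_le_of_le a (iInf_le_of_le b (iInf_le _ ⟨hx, hy⟩)))

lemma le_pathDist_add {x y : G.MetricGraph} {r s : ℝ≥0∞}
    (he : ∀ a b, x.LiesOn a b → y.LiesOn a b → r ≤ ENNReal.ofReal |x.coord a - y.coord a| + s)
    (hv : ∀ a b, x.coord a ≠ 0 → y.coord b ≠ 0 →
      r ≤ ENNReal.ofReal (1 - x.coord a) + (G.edist a b : ℝ≥0∞) +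
        ENNReal.ofReal (1 - y.coord b) + s) :
    r ≤ pathDist x y + s := by
  rcases min_choice (edgeDist x y) (vertexDist x y) with h | h
  · rw [pathDist, h, edgeDist]
    simp only [ENNReal.iInf_add, le_iInf_iff]
    exact fun a b h => he a b h.1 h.2
  · rw [pathDist, h, vertexDist]
    simp only [ENNReal.iInf_add, le_iInf_iff]
    exact fun a b h => hv a b h.1 h.2

lemma pathDist_self (x : G.MetricGraph) : pathDist x x = 0 := by
  obtain ⟨a, b, h⟩ := exists_liesOn x
  have := pathDist_le_edge h h
  simpa using this

lemma pathDist_comm_le (x y : G.MetricGraph) : pathDist x y ≤ pathDist y x := by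
  rw [← add_zero (pathDist y x)]
  refine le_pathDist_add (fun a b hy hx => ?_) (fun a b hy hx => ?_)
  · rw [add_zero, abs_sub_comm]
    exact pathDist_le_edge hx hy
  · refine (pathDist_le_vertex hx hy).trans (le_of_eq ?_)
    rw [SimpleGraph.edist_comm]
    ring

lemma pathDist_comm (x y : G.MetricGraph) : pathDist x y = pathDist y x :=
  le_antisymm (pathDist_comm_le x y) (pathDist_comm_le y x)

lemma edist_le_of_coord {y : G.MetricGraph} {a b : V} (ha : y.coord a ≠ 0) (hb : y.coord b ≠ 0) :
    (G.edist a b : ℝ≥0∞) ≤ ENNReal.ofReal (1 - y.coord a) + ENNReal.ofReal (1 - y.coord b) := by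
  by_cases hab : a = b
  · simp [hab]
  obtain ⟨c, d, h⟩ := exists_liesOn y
  have hy : y.LiesOn a b := by
    rcases h.2 a ha with rfl | rfl <;> rcases h.2 b hb with rfl | rfl
    · exact absurd rfl hab
    · exact h
    · exact h.swap
    · exact absurd rfl hab
  have hadj : G.Adj a b := hy.1.resolve_left hab
  have hsum := coord_add hy hab
  have h1 := coord_nonneg y a
  have h2 := coord_nonneg y b
  rw [SimpleGraph.edist_eq_one_iff_adj.2 hadj, ← ENNReal.ofReal_add (by linarith) (by linarith)]
  simp [show 1 - y.coord a + (1 - y.coord b) = 1 by linarith]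

lemma exists_vertex_le {x y : G.MetricGraph} {a b c : V} (hx : x.LiesOn a b) (hy : y.LiesOn a b)
    (hc : y.coord c ≠ 0) :
    ∃ d, x.coord d ≠ 0 ∧ ENNReal.ofReal (1 - x.coord d) + (G.edist d c : ℝ≥0∞) ≤
      ENNReal.ofReal |x.coord a - y.coord a| + ENNReal.ofReal (1 - y.coord c) := by
  wlog hca : c = a generalizing a b
  · rw [abs_coord_sub_eq hx hy]
    exact this hx.swap hy.swap ((hy.2 c hc).resolve_left hca)
  subst hca
  by_cases hcb : c = b
  · subst hcb
    refine ⟨c, ?_, ?_⟩ <;> simp [coord_self hx]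
  have h1 := coord_add hx hcb
  have h2 := coord_add hy hcb
  have h3 := coord_nonneg y b
  by_cases hxc : x.coord c = 0
  · refine ⟨b, by intro h; linarith, ?_⟩
    have hadj : G.Adj b c := (hx.1.resolve_left hcb).symm
    rw [SimpleGraph.edist_eq_one_iff_adj.2 hadj,
      ← ENNReal.ofReal_add (abs_nonneg _) (by linarith), hxc, zero_sub, abs_neg,
      abs_of_nonneg (coord_nonneg y c)]
    simp [show x.coord b = 1 by linarith]
  · refine ⟨c, hxc, ?_⟩
    rw [← ENNReal.ofReal_add (abs_nonneg _) (by linarith), SimpleGraph.edist_self]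
    simp only [ENat.toENNReal_zero, add_zero]
    apply ENNReal.ofReal_le_ofReal
    have := neg_abs_le (x.coord c - y.coord c)
    linarith

lemma pathDist_triangle (x y z : G.MetricGraph) :
    pathDist x z ≤ pathDist x y + pathDist y z := by
  have mixed : ∀ {x y z : G.MetricGraph} {a b c d : V}, x.LiesOn a b → y.LiesOn a b →
      y.coord c ≠ 0 → z.coord d ≠ 0 → pathDist x z ≤ ENNReal.ofReal |x.coord a - y.coord a| +
        (ENNReal.ofReal (1 - y.coord c) + (G.edist c d : ℝ≥0∞) +
          ENNReal.ofReal (1 - z.coord d)) := by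
    intro x y z a b c d hx hy hc hd
    obtain ⟨e, he, hle⟩ := exists_vertex_le hx hy hc
    have htri : (G.edist e d : ℝ≥0∞) ≤ G.edist e c + G.edist c d := by
      rw [← ENat.toENNReal_add]
      exact ENat.toENNReal_le.2 SimpleGraph.edist_triangle
    calc pathDist x z ≤ _ := pathDist_le_vertex he hd
      _ ≤ ENNReal.ofReal (1 - x.coord e) + (G.edist e c + G.edist c d) +
          ENNReal.ofReal (1 - z.coord d) := by gcongr
      _ = (ENNReal.ofReal (1 - x.coord e) + G.edist e c) + (G.edist c d +
          ENNReal.ofReal (1 - z.coord d)) := by ring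
      _ ≤ (ENNReal.ofReal |x.coord a - y.coord a| + ENNReal.ofReal (1 - y.coord c)) +
          (G.edist c d + ENNReal.ofReal (1 - z.coord d)) := by gcongr
      _ = _ := by ring
  refine le_pathDist_add (fun a b hx hy => ?_) (fun a b hx hy => ?_)
  · rw [add_comm]
    refine le_pathDist_add (fun c d hy' hz => ?_) (fun c d hy' hz => ?_)
    · -- both segments lie in edges
      by_cases hex : ∃ e, y.LiesOn e e
      · obtain ⟨e, he⟩ := hex
        have hye : y.coord e ≠ 0 := by rw [coord_self he]; exact one_ne_zero
        obtain ⟨f, hf, hle⟩ := exists_vertex_le hz.swap hy'.swap hye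
        rw [← abs_coord_sub_eq hz hy', coord_self he, sub_self, ENNReal.ofReal_zero, add_zero,
          abs_sub_comm] at hle
        refine (mixed hx hy hye hf).trans ?_
        rw [coord_self he, sub_self, ENNReal.ofReal_zero, zero_add, add_comm,
          SimpleGraph.edist_comm, add_comm (G.edist f e : ℝ≥0∞)]
        gcongr
      · push Not at hex
        have key : ∀ {p q : V}, y.LiesOn p q → p ≠ q ∧ y.coord p ≠ 0 ∧ y.coord q ≠ 0 := by
          intro p q hpq
          refine ⟨?_, ?_, ?_⟩
          · rintro rfl
            exact hex p hpq
          · intro h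
            refine hex q ⟨Or.inl rfl, fun w hw => Or.inl ?_⟩
            rcases hpq.2 w hw with rfl | rfl
            · exact absurd h hw
            · rfl
          · intro h
            refine hex p ⟨Or.inl rfl, fun w hw => Or.inl ?_⟩
            rcases hpq.2 w hw with rfl | rfl
            · rfl
            · exact absurd h hw
        have hcd := key hy'
        have habs : |y.coord c - z.coord c| = |y.coord a - z.coord a| ∧ z.LiesOn a b := by
          rcases hy.2 c hcd.2.1 with rfl | rfl
          · rcases hy.2 d hcd.2.2 with rfl | rfl
            · exact absurd rfl hcd.1
            · exact ⟨rfl, hz⟩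
          · rcases hy.2 d hcd.2.2 with rfl | rfl
            · exact ⟨abs_coord_sub_eq hy' hz, hz.swap⟩
            · exact absurd rfl hcd.1
        rw [habs.1, add_comm, ← ENNReal.ofReal_add (abs_nonneg _) (abs_nonneg _)]
        refine (pathDist_le_edge hx habs.2).trans (ENNReal.ofReal_le_ofReal ?_)
        exact abs_sub_le _ _ _
    · rw [add_comm]
      exact mixed hx hy hy' hz
  · rw [add_comm]
    refine le_pathDist_add (fun c d hy' hz => ?_) (fun c d hy' hz => ?_)
    · rw [pathDist_comm x z, abs_sub_comm]
      refine (mixed hz hy' hy hx).trans (le_of_eq ?_)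
      rw [SimpleGraph.edist_comm]
      ring
    · have htri : (G.edist a d : ℝ≥0∞) ≤ G.edist a b + G.edist b c + G.edist c d := by
        rw [← ENat.toENNReal_add, ← ENat.toENNReal_add]
        exact ENat.toENNReal_le.2 (SimpleGraph.edist_triangle.trans
          (add_le_add_left SimpleGraph.edist_triangle _))
      calc pathDist x z ≤ _ := pathDist_le_vertex hx hz
        _ ≤ ENNReal.ofReal (1 - x.coord a) + (G.edist a b +
            (ENNReal.ofReal (1 - y.coord b) + ENNReal.ofReal (1 - y.coord c)) + G.edist c d) +
            ENNReal.ofReal (1 - z.coord d) := by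
          gcongr
          refine htri.trans ?_
          gcongr
          exact edist_le_of_coord hy hy'
        _ = _ := by ring

/-- The metric graph with its path metric. -/
noncomputable instance : PseudoEMetricSpace G.MetricGraph where
  edist := pathDist
  edist_self := pathDist_self
  edist_comm := pathDist_comm
  edist_triangle := pathDist_triangle

end MetricGraph

/-- The vertex set of `G`, as a metric subspace of the metric graph of `G`. -/
def VertexSpace (_G : SimpleGraph V) : Type u := V

noncomputable instance (G : SimpleGraph V) : PseudoEMetricSpace G.VertexSpace :=
  PseudoEMetricSpace.induced (MetricGraph.vertex G) inferInstance

/-- The map `w ↦ (w, v₀)` from `V(G)` to `V(G × H)`. -/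
def sliceMap (G : SimpleGraph V) (H : SimpleGraph W) (v₀ : W) :
    G.VertexSpace → (G.directProd H).VertexSpace :=
  fun w => ((w, v₀) : V × W)

end SimpleGraph

section Metric

variable {X : Type u} {Y : Type v} [PseudoEMetricSpace X] [PseudoEMetricSpace Y]

/-- `S` is (the image of) a geodesic from `x` to `y`, parametrized by arc length on `[0, L]`. -/
def IsGeodesicSegment (S : Set X) (x y : X) : Prop :=
  ∃ (L : ℝ) (γ : ℝ → X), 0 ≤ L ∧ γ 0 = x ∧ γ L = y ∧
    (∀ s ∈ Set.Icc 0 L, ∀ t ∈ Set.Icc 0 L, edist (γ s) (γ t) = ENNReal.ofReal |s - t|) ∧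
    S = γ '' Set.Icc 0 L

/-- `S` is contained in the (closed) `δ`-neighborhood of `T`. -/
def IsInNeighborhood (δ : ℝ≥0) (S T : Set X) : Prop :=
  ∀ p ∈ S, ∃ q ∈ T, edist p q ≤ δ

/-- Each side of the triangle with sides `A`, `B`, `C` lies in the `δ`-neighborhood of the union
of the two other sides. -/
def IsThinTriangle (δ : ℝ≥0) (A B C : Set X) : Prop :=
  IsInNeighborhood δ A (B ∪ C) ∧ IsInNeighborhood δ B (C ∪ A) ∧ IsInNeighborhood δ C (A ∪ B)

variable (X) in
/-- Gromov hyperbolicity (Rips condition): for some `δ`, all geodesic triangles are `δ`-thin.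
The distance may take the value `∞`; a geodesic triangle lies in one component (class of points
at finite distance), so that one `δ` has to serve all components. -/
def IsGromovHyperbolic : Prop :=
  ∃ δ : ℝ≥0, ∀ (x y z : X) (A B C : Set X), IsGeodesicSegment A x y → IsGeodesicSegment B y z →
    IsGeodesicSegment C z x → IsThinTriangle δ A B C

/-- `f` is an `(α, β)`-quasi-isometric embedding:
`α⁻¹ d(x, y) - β ≤ d(f x, f y) ≤ α d(x, y) + β`. -/
def IsQuasiIsometricEmbedding (α β : ℝ≥0) (f : X → Y) : Prop :=
  1 ≤ α ∧ ∀ x y, (α : ℝ≥0∞)⁻¹ * edist x y ≤ edist (f x) (f y) + β ∧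
    edist (f x) (f y) ≤ α * edist x y + β

/-- `f` is `ε`-full: every point of `Y` is within `ε` of the image of `f`. -/
def IsFull (ε : ℝ≥0) (f : X → Y) : Prop :=
  ∀ y, ∃ x, edist (f x) y ≤ ε

variable (X) in
/-- The space has finite diameter. -/
def IsBoundedSpace : Prop := Metric.ediam (Set.univ : Set X) ≠ ⊤

end Metric

/-!
The proof goes through Gromov's four-point condition. In a space where distances are finite, this
condition makes geodesic triangles thin (`IsFourPointHyperbolic.isGromovHyperbolic`); conversely,
thin triangles give the four-point condition on any set of points which are pairwise joined by
geodesics (`IsGromovHyperbolic.isFourPointHyperbolic`). The latter rests on the fact that in a thin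
triangle with vertices `w`, `x`, `y` the distance from `w` to the side `[x, y]` is, up to a
constant, the Gromov product of `x` and `y` based at `w`. For a connected graph, vertices are joined
by geodesics (run along a shortest walk) and every point is near a vertex, so that hyperbolicity is
a property of the distances between vertices (`SimpleGraph.Connected.isGromovHyperbolic_iff`).

Since the four-point condition only compares sums of distances, it passes to any space with a map
that changes distances by a bounded additive amount (`IsFourPointHyperbolic.of_roughIsometry`), and
no stability of quasi-geodesics is needed. It remains to exhibit such maps in both directions: the
slice `w ↦ (w, v₀)` and the projection to the first factor.

A walk in the direct product is a pair of walks of the same length. A walk can be lengthened by any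
even number, going back and forth along an edge, so only parity matters, and it is corrected by an
odd cycle of the second factor (`SimpleGraph.edist_slice_le`). If the first factor is non-trivial,
each vertex of the product is within the diameter of the second factor from the slice
(`SimpleGraph.exists_edist_slice_le`), which bounds all distances in the product
(`SimpleGraph.edist_directProd_le`). If the first factor is a
single vertex, the product has no edges and both sides are trivially hyperbolic.
-/

/-! ### The four-point condition -/

section FourPoint

variable {X : Type u} {Y : Type v}

variable (X) in
/-- Gromov's four-point condition, for distances which may be infinite: among the three sums
`d(x, z) + d(y, w)`, `d(x, y) + d(z, w)`, `d(x, w) + d(y, z)`, each is at most the maximum of the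
other two, up to a constant. -/
def IsFourPointHyperbolic [PseudoEMetricSpace X] : Prop :=
  ∃ δ : ℝ≥0, ∀ x y z w : X,
    edist x z + edist y w ≤ max (edist x y + edist z w) (edist x w + edist y z) + δ

/-- The four-point condition pulls back along maps that distort distances by a bounded additive
amount; this is where a multiplicative constant `1` matters. -/
lemma IsFourPointHyperbolic.of_roughIsometry [PseudoEMetricSpace X] [PseudoEMetricSpace Y]
    (h : IsFourPointHyperbolic Y) (f : X → Y) (β : ℝ≥0)
    (hle : ∀ x y, edist x y ≤ edist (f x) (f y) + β)
    (hge : ∀ x y, edist (f x) (f y) ≤ edist x y + β) : IsFourPointHyperbolic X := by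
  obtain ⟨δ, h⟩ := h
  refine ⟨δ + 4 * β, fun x y z w => ?_⟩
  have key : ∀ a b c d : X, edist (f a) (f b) + edist (f c) (f d) ≤
      edist a b + edist c d + 2 * β := fun a b c d =>
    (add_le_add (hge a b) (hge c d)).trans (le_of_eq (by ring))
  calc edist x z + edist y w
      ≤ (edist (f x) (f z) + β) + (edist (f y) (f w) + β) := add_le_add (hle _ _) (hle _ _)
    _ = (edist (f x) (f z) + edist (f y) (f w)) + 2 * β := by ring
    _ ≤ (max (edist (f x) (f y) + edist (f z) (f w)) (edist (f x) (f w) + edist (f y) (f z)) + δ)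
        + 2 * β := add_le_add (h _ _ _ _) le_rfl
    _ ≤ (max (edist x y + edist z w + 2 * β) (edist x w + edist y z + 2 * β) + δ) + 2 * β :=
        add_le_add (add_le_add (max_le_max (key _ _ _ _) (key _ _ _ _)) le_rfl) le_rfl
    _ = max (edist x y + edist z w) (edist x w + edist y z) + ((δ + 4 * β : ℝ≥0) : ℝ≥0∞) := by
        rw [max_add_add_right]; push_cast; ring

lemma isFourPointHyperbolic_iff_dist [PseudoMetricSpace X] :
    IsFourPointHyperbolic X ↔ ∃ δ : ℝ, ∀ x y z w : X,
      dist x z + dist y w ≤ max (dist x y + dist z w) (dist x w + dist y z) + δ := by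
  have cast : ∀ (δ : ℝ≥0) (x y z w : X),
      edist x z + edist y w ≤ max (edist x y + edist z w) (edist x w + edist y z) + δ ↔
      dist x z + dist y w ≤ max (dist x y + dist z w) (dist x w + dist y z) + δ := by
    intro δ x y z w
    simp only [edist_nndist]
    norm_cast
  constructor
  · rintro ⟨δ, h⟩
    exact ⟨δ, fun x y z w => (cast δ x y z w).1 (h x y z w)⟩
  · rintro ⟨δ, h⟩
    refine ⟨δ.toNNReal, fun x y z w => (cast _ x y z w).2 ((h x y z w).trans ?_)⟩
    gcongr
    exact Real.le_coe_toNNReal δ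

end FourPoint

/-! ### Geodesic triangles and the four-point condition -/

section Geodesic

/-- A `1`-Lipschitz path whose ends are as far apart as its length is a geodesic. -/
lemma isGeodesicSegment_of_le {X : Type u} [PseudoEMetricSpace X] {γ : ℝ → X} {L : ℝ} (hL : 0 ≤ L)
    (hγ : ∀ s t, 0 ≤ s → s ≤ t → t ≤ L → edist (γ s) (γ t) ≤ ENNReal.ofReal (t - s))
    (hends : ENNReal.ofReal L ≤ edist (γ 0) (γ L)) :
    IsGeodesicSegment (γ '' Set.Icc 0 L) (γ 0) (γ L) := by
  refine ⟨L, γ, hL, rfl, rfl, fun s hs t ht => ?_, rfl⟩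
  wlog hst : s ≤ t generalizing s t
  · rw [edist_comm, abs_sub_comm]
    exact this t ht s hs (le_of_not_ge hst)
  rw [abs_sub_comm, abs_of_nonneg (sub_nonneg.2 hst)]
  refine le_antisymm (hγ s t hs.1 hst ht.2) ?_
  have h1 : ENNReal.ofReal s + ENNReal.ofReal (t - s) + ENNReal.ofReal (L - t) ≤
      ENNReal.ofReal s + edist (γ s) (γ t) + ENNReal.ofReal (L - t) := by
    calc ENNReal.ofReal s + ENNReal.ofReal (t - s) + ENNReal.ofReal (L - t)
        = ENNReal.ofReal L := by
          rw [← ENNReal.ofReal_add hs.1 (by linarith),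
            ← ENNReal.ofReal_add (by linarith [hs.1]) (by linarith [ht.2])]
          congr 1
          ring
      _ ≤ edist (γ 0) (γ L) := hends
      _ ≤ edist (γ 0) (γ s) + edist (γ s) (γ t) + edist (γ t) (γ L) := edist_triangle4 _ _ _ _
      _ ≤ _ := by
          gcongr
          · simpa using hγ 0 s le_rfl hs.1 hs.2
          · exact hγ t L ht.1 ht.2 le_rfl
  rwa [ENNReal.add_le_add_iff_right ENNReal.ofReal_ne_top,
    ENNReal.add_le_add_iff_left ENNReal.ofReal_ne_top] at h1

variable {X : Type u} [PseudoMetricSpace X] {S A B C : Set X} {x y z w p q : X}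

lemma isInNeighborhood_iff_dist {δ : ℝ≥0} :
    IsInNeighborhood δ S A ↔ ∀ p ∈ S, ∃ q ∈ A, dist p q ≤ δ := by
  simp only [IsInNeighborhood, edist_nndist, ENNReal.coe_le_coe, ← NNReal.coe_le_coe, coe_nndist]

/-- The parametrization of a geodesic segment, in terms of real distances. -/
lemma IsGeodesicSegment.exists_param (h : IsGeodesicSegment S x y) :
    ∃ γ : ℝ → X, γ 0 = x ∧ γ (dist x y) = y ∧
      (∀ s ∈ Set.Icc 0 (dist x y), ∀ t ∈ Set.Icc 0 (dist x y), dist (γ s) (γ t) = |s - t|) ∧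
      S = γ '' Set.Icc 0 (dist x y) := by
  obtain ⟨L, γ, hL, rfl, rfl, hd, rfl⟩ := h
  have hd' : ∀ s ∈ Set.Icc 0 L, ∀ t ∈ Set.Icc 0 L, dist (γ s) (γ t) = |s - t| := by
    intro s hs t ht
    rw [dist_edist, hd s hs t ht, ENNReal.toReal_ofReal (abs_nonneg _)]
  have hL' : dist (γ 0) (γ L) = L := by
    rw [hd' 0 ⟨le_rfl, hL⟩ L ⟨hL, le_rfl⟩, zero_sub, abs_neg, abs_of_nonneg hL]
  exact ⟨γ, rfl, by rw [hL'], by rwa [hL'], by rw [hL']⟩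

lemma IsGeodesicSegment.dist_add_dist (h : IsGeodesicSegment S x y) (hp : p ∈ S) :
    dist x p + dist p y = dist x y := by
  obtain ⟨γ, h0, h1, hd, rfl⟩ := h.exists_param
  obtain ⟨t, ht, rfl⟩ := hp
  have e1 := hd 0 ⟨le_rfl, dist_nonneg⟩ t ht
  have e2 := hd t ht _ ⟨dist_nonneg, le_rfl⟩
  rw [h0, zero_sub, abs_neg, abs_of_nonneg ht.1] at e1
  rw [h1, abs_sub_comm, abs_of_nonneg (sub_nonneg.2 ht.2)] at e2
  linarith

lemma IsGeodesicSegment.left_mem (h : IsGeodesicSegment S x y) : x ∈ S := by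
  obtain ⟨γ, h0, -, -, rfl⟩ := h.exists_param
  exact ⟨0, ⟨le_rfl, dist_nonneg⟩, h0⟩

lemma IsGeodesicSegment.right_mem (h : IsGeodesicSegment S x y) : y ∈ S := by
  obtain ⟨γ, -, h1, -, rfl⟩ := h.exists_param
  exact ⟨_, ⟨dist_nonneg, le_rfl⟩, h1⟩

lemma IsGeodesicSegment.exists_dist_eq (h : IsGeodesicSegment S x y) {r : ℝ} (hr : 0 ≤ r)
    (hr' : r ≤ dist x y) : ∃ q ∈ S, dist x q = r := by
  obtain ⟨γ, h0, -, hd, hS⟩ := h.exists_param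
  refine ⟨γ r, hS ▸ ⟨r, ⟨hr, hr'⟩, rfl⟩, ?_⟩
  have e1 := hd 0 ⟨le_rfl, dist_nonneg⟩ r ⟨hr, hr'⟩
  rwa [h0, zero_sub, abs_neg, abs_of_nonneg hr] at e1

/-- If the sets `A` and `B` cover a geodesic segment up to `δ`, and each comes within `δ` of an
end, then some point of the segment is within `δ + 1` of both. -/
lemma IsGeodesicSegment.exists_near_both (h : IsGeodesicSegment S x y) {δ : ℝ}
    (hcov : ∀ p ∈ S, ∃ q ∈ A ∪ B, dist p q ≤ δ) (hA : ∃ q ∈ A, dist x q ≤ δ)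
    (hB : ∃ q ∈ B, dist y q ≤ δ) :
    ∃ p ∈ S, (∃ q ∈ A, dist p q ≤ δ + 1) ∧ ∃ q ∈ B, dist p q ≤ δ + 1 := by
  obtain ⟨γ, h0, h1, hd, hS⟩ := h.exists_param
  -- The parameters of points near `T`; thickening them makes an open set, so that connectedness
  -- of the interval of parameters applies.
  let near : Set X → Set ℝ := fun T => {t ∈ Set.Icc 0 (dist x y) | ∃ q ∈ T, dist (γ t) q ≤ δ}
  have hnear : ∀ T, ∀ t ∈ Set.Icc 0 (dist x y), t ∈ Metric.thickening 1 (near T) →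
      ∃ q ∈ T, dist (γ t) q ≤ δ + 1 := by
    intro T t ht htT
    obtain ⟨s, ⟨hs, q, hq, hsq⟩, hts⟩ := Metric.mem_thickening_iff.1 htT
    refine ⟨q, hq, (dist_triangle _ (γ s) _).trans ?_⟩
    rw [hd t ht s hs, ← Real.dist_eq]
    linarith
  have hsub : ∀ T, near T ⊆ Metric.thickening 1 (near T) := fun T =>
    Metric.self_subset_thickening one_pos _
  have h0mem : (0 : ℝ) ∈ Set.Icc 0 (dist x y) := ⟨le_rfl, dist_nonneg⟩
  have h1mem : dist x y ∈ Set.Icc 0 (dist x y) := ⟨dist_nonneg, le_rfl⟩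
  obtain ⟨t, ht, htA, htB⟩ := isPreconnected_Icc (a := (0 : ℝ)) (b := dist x y)
    _ _ (Metric.isOpen_thickening (δ := 1) (E := near A))
    (Metric.isOpen_thickening (δ := 1) (E := near B))
    (by
      intro t ht
      obtain ⟨q, hq, hle⟩ := hcov (γ t) (hS ▸ ⟨t, ht, rfl⟩)
      exact hq.imp (fun hq => hsub A ⟨ht, q, hq, hle⟩) fun hq => hsub B ⟨ht, q, hq, hle⟩)
    ⟨0, h0mem, hsub A ⟨h0mem, by rwa [h0]⟩⟩ ⟨_, h1mem, hsub B ⟨h1mem, by rwa [h1]⟩⟩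
  exact ⟨γ t, hS ▸ ⟨t, ht, rfl⟩, hnear A t ht htA, hnear B t ht htB⟩

/-- Twice the Gromov product `(x | y)` based at `w` bounds from below the double distance from `w`
to a geodesic `[x, y]`. -/
lemma IsGeodesicSegment.gromov_le (h : IsGeodesicSegment S x y) (hp : p ∈ S) (w : X) :
    dist w x + dist w y - dist x y ≤ 2 * dist w p := by
  have e := h.dist_add_dist hp
  have e1 := dist_triangle w p x
  have e2 := dist_triangle w p y
  rw [dist_comm p x] at e1
  linarith

/-- In a thin triangle with vertices `w`, `x`, `y`, the side `[x, y]` comes as close to `w` as the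
Gromov product `(x | y)` based at `w` allows. -/
lemma exists_le_gromov {δ : ℝ≥0} (hA : IsGeodesicSegment A w x) (hB : IsGeodesicSegment B x y)
    (hC : IsGeodesicSegment C y w) (hthin : IsThinTriangle δ A B C) :
    ∃ p ∈ B, 2 * dist w p ≤ dist w x + dist w y - dist x y + 4 * (δ + 1) := by
  have hδ : (0 : ℝ) ≤ δ := δ.2
  obtain ⟨p, hp, ⟨q, hq, hpq⟩, r, hr, hpr⟩ := hB.exists_near_both (A := A) (B := C)
    (by rw [Set.union_comm]; exact isInNeighborhood_iff_dist.1 hthin.2.1)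
    ⟨x, hA.right_mem, by simp⟩ ⟨y, hC.left_mem, by simp⟩
  refine ⟨p, hp, ?_⟩
  have e1 := hA.dist_add_dist hq
  have e2 := hC.dist_add_dist hr
  have e3 := hB.dist_add_dist hp
  have t1 := dist_triangle w q p
  have t2 := dist_triangle x q p
  have t3 := dist_triangle w r p
  have t4 := dist_triangle y r p
  simp only [dist_comm q p, dist_comm r p, dist_comm q x, dist_comm y w, dist_comm r w,
    dist_comm p y] at *
  linarith

/-- Thin triangles give the four-point condition on any set of points which are pairwise joined by
geodesics. -/
lemma IsGromovHyperbolic.isFourPointHyperbolic {Y : Type v} [PseudoEMetricSpace Y] {f : Y → X}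
    (h : IsGromovHyperbolic X) (hf : ∀ a b, edist (f a) (f b) = edist a b)
    (hgeo : ∀ a b, ∃ A, IsGeodesicSegment A (f a) (f b)) : IsFourPointHyperbolic Y := by
  obtain ⟨δ, h⟩ := h
  have hδ : (0 : ℝ) ≤ δ := δ.2
  refine ⟨6 * δ + 4, fun x' y' z' w' => ?_⟩
  obtain ⟨Awx, hAwx⟩ := hgeo w' x'
  obtain ⟨Axz, hAxz⟩ := hgeo x' z'
  obtain ⟨Azw, hAzw⟩ := hgeo z' w'
  obtain ⟨Azy, hAzy⟩ := hgeo z' y'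
  obtain ⟨Ayx, hAyx⟩ := hgeo y' x'
  simp only [← hf]
  generalize f x' = x at *
  generalize f y' = y at *
  generalize f z' = z at *
  generalize f w' = w at *
  obtain ⟨p, hp, hle⟩ := exists_le_gromov hAwx hAxz hAzw (h _ _ _ _ _ _ hAwx hAxz hAzw)
  obtain ⟨q, hq, hpq⟩ := isInNeighborhood_iff_dist.1 (h _ _ _ _ _ _ hAxz hAzy hAyx).1 p hp
  have key : dist x z + dist y w ≤
      max (dist x y + dist z w) (dist x w + dist y z) + (6 * δ + 4) := by
    have t := dist_triangle w p q
    rw [← sub_le_iff_le_add, le_max_iff]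
    rcases hq with hq | hq
    · right
      have := hAzy.gromov_le hq w
      simp only [dist_comm z y, dist_comm x w, dist_comm y w] at *
      linarith
    · left
      have := hAyx.gromov_le hq w
      simp only [dist_comm z w, dist_comm x y, dist_comm y w] at *
      linarith
  simp only [edist_nndist]
  norm_cast

/-- Under the four-point condition, a point `p` for which `d(x, p) + d(p, z)` is almost `d(x, z)`
is close to every geodesic `[x, z]`. -/
lemma IsGeodesicSegment.exists_near_of_dist_add_dist_le {δ : ℝ}
    (h : ∀ x y z w : X,
      dist x z + dist y w ≤ max (dist x y + dist z w) (dist x w + dist y z) + δ)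
    (hS : IsGeodesicSegment S x z) (hp : dist x p + dist p z ≤ dist x z + δ) :
    ∃ q ∈ S, dist p q ≤ 2 * δ := by
  have hδ : 0 ≤ δ := by simpa using h x x x x
  rcases le_total (dist x p) (dist x z) with hle | hle
  · -- the point of the geodesic at the same distance from `x` as `p`
    obtain ⟨q, hq, hxq⟩ := hS.exists_dist_eq dist_nonneg hle
    refine ⟨q, hq, ?_⟩
    have e := hS.dist_add_dist hq
    have h4 := h p x q z
    rw [dist_comm p x] at h4
    rcases le_max_iff.1 (sub_le_iff_le_add.2 h4) with h5 | h5 <;> linarith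
  · exact ⟨z, hS.right_mem, by linarith⟩

/-- The four-point condition makes geodesic triangles thin. -/
lemma IsFourPointHyperbolic.isGromovHyperbolic (h : IsFourPointHyperbolic X) :
    IsGromovHyperbolic X := by
  obtain ⟨δ, h⟩ := isFourPointHyperbolic_iff_dist.1 h
  have side : ∀ {x y z : X} {A B C : Set X}, IsGeodesicSegment A x y → IsGeodesicSegment B y z →
      IsGeodesicSegment C z x → IsInNeighborhood (2 * δ).toNNReal A (B ∪ C) := by
    intro x y z A B C hA hB hC
    refine isInNeighborhood_iff_dist.2 fun p hp => ?_
    have e := hA.dist_add_dist hp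
    have h4 := h x p y z
    rcases le_max_iff.1 (sub_le_iff_le_add.2 h4) with h5 | h5
    · obtain ⟨q, hq, hpq⟩ := hB.exists_near_of_dist_add_dist_le h (p := p)
        (by rw [dist_comm y p]; linarith)
      exact ⟨q, Or.inl hq, hpq.trans (Real.le_coe_toNNReal _)⟩
    · obtain ⟨q, hq, hpq⟩ := hC.exists_near_of_dist_add_dist_le h (p := p)
        (by rw [dist_comm z p, dist_comm p x, dist_comm z x]; linarith)
      exact ⟨q, Or.inr hq, hpq.trans (Real.le_coe_toNNReal _)⟩
  exact ⟨_, fun x y z A B C hA hB hC => ⟨side hA hB hC, side hB hC hA, side hC hA hB⟩⟩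

end Geodesic

namespace SimpleGraph

variable {V : Type u} {W : Type v} {G : SimpleGraph V} {H : SimpleGraph W}

/-! ### Vertices and geodesics of the metric graph -/

namespace MetricGraph

@[simp]
lemma coord_vertex_self (a : V) : (vertex G a).coord a = 1 := by simp [coord, vertex]

lemma eq_of_coord_vertex_ne_zero {a b : V} (h : (vertex G a).coord b ≠ 0) : b = a := by
  classical
  by_contra hne
  exact h (Finsupp.single_eq_of_ne hne)

lemma edist_vertex (a b : V) : EDist.edist (vertex G a) (vertex G b) = (G.edist a b : ℝ≥0∞) := by
  refine le_antisymm ?_ ?_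
  · refine (pathDist_le_vertex (a := a) (b := b) (by simp) (by simp)).trans (le_of_eq ?_)
    simp
  · rw [← add_zero (EDist.edist (vertex G a) (vertex G b))]
    refine le_pathDist_add (fun c d ha hb => ?_) (fun c d hc hd => ?_)
    · have hab : a = b ∨ G.Adj a b := by
        have hcd := ha.1
        have hcd' := ha.swap.1
        rcases ha.2 a (by simp) with rfl | rfl <;> rcases hb.2 b (by simp) with rfl | rfl
        · exact Or.inl rfl
        · exact hcd
        · exact hcd'
        · exact Or.inl rfl
      rcases hab with rfl | hab
      · simp
      · have hc : c = a ∨ c = b := by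
          by_contra! hc
          have h1 : (vertex G a).coord c = 0 := by
            by_contra h; exact hc.1 (eq_of_coord_vertex_ne_zero h)
          have h2 := (ha.2 a (by simp)).resolve_left (Ne.symm hc.1)
          have h3 := (hb.2 b (by simp)).resolve_left (Ne.symm hc.2)
          exact hab.ne (h2.trans h3.symm)
        have h1 : ∀ {p q : V}, p ≠ q → (vertex G p).coord q = 0 := fun {p q} hpq => by
          by_contra h; exact hpq (eq_of_coord_vertex_ne_zero h).symm
        rw [edist_eq_one_iff_adj.2 hab]
        rcases hc with rfl | rfl
        · simp [h1 hab.ne']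
        · simp [h1 hab.ne]
    · rw [eq_of_coord_vertex_ne_zero hc, eq_of_coord_vertex_ne_zero hd]
      simp

/-- Every point is within `1` of a vertex: an end of its edge. -/
lemma exists_edist_vertex_le_one (x : G.MetricGraph) : ∃ a, EDist.edist (vertex G a) x ≤ 1 := by
  obtain ⟨a, b, h⟩ := exists_liesOn x
  have ha : ∃ a, x.coord a ≠ 0 := by
    by_cases hab : a = b
    · subst hab
      exact ⟨a, by simp [coord_self h]⟩
    · by_contra! h0
      have := coord_add h hab
      simp [h0] at this
  obtain ⟨c, hc⟩ := ha
  refine ⟨c, (pathDist_le_vertex (a := c) (b := c) (by simp) hc).trans ?_⟩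
  simp [coord_nonneg x c]

lemma edist_ne_top (hG : G.Connected) (x y : G.MetricGraph) : EDist.edist x y ≠ ⊤ := by
  obtain ⟨a, ha⟩ := exists_edist_vertex_le_one x
  obtain ⟨b, hb⟩ := exists_edist_vertex_le_one y
  refine ne_top_of_le_ne_top ?_ (edist_triangle4 x (vertex G a) (vertex G b) y)
  have h : G.edist a b ≠ ⊤ := edist_ne_top_iff_reachable.2 (hG a b)
  rw [edist_vertex, PseudoEMetricSpace.edist_comm x]
  refine ENNReal.add_ne_top.2 ⟨ENNReal.add_ne_top.2 ⟨?_, by simpa using h⟩, ?_⟩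
  · exact ne_top_of_le_ne_top ENNReal.one_ne_top ha
  · exact ne_top_of_le_ne_top ENNReal.one_ne_top hb

/-- A sequence of vertices, consecutive ones equal or adjacent, is traversed by a `1`-Lipschitz
path. -/
lemma exists_lipschitz_path (p : ℕ → V) (hp : ∀ i, p i = p (i + 1) ∨ G.Adj (p i) (p (i + 1))) :
    ∃ γ : ℝ → G.MetricGraph, (∀ n : ℕ, γ n = vertex G (p n)) ∧
      ∀ s t, 0 ≤ s → s ≤ t → EDist.edist (γ s) (γ t) ≤ ENNReal.ofReal (t - s) := by
  classical
  let γ : ℝ → G.MetricGraph := fun t =>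
    ⟨Finsupp.single (p ⌊t⌋₊) (1 - Int.fract t) + Finsupp.single (p (⌊t⌋₊ + 1)) (Int.fract t),
      _, _, hp _, _, ⟨Int.fract_nonneg t, (Int.fract_lt_one t).le⟩, rfl⟩
  have hnat : ∀ n : ℕ, γ n = vertex G (p n) := fun n => Subtype.ext (by simp [γ, vertex])
  -- the formula for `γ` on a closed unit interval, right end included
  have hγ : ∀ (i : ℕ) (t : ℝ), (i : ℝ) ≤ t → t ≤ i + 1 → (γ t).1 =
      Finsupp.single (p i) (1 - (t - i)) + Finsupp.single (p (i + 1)) (t - i) := by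
    intro i t h1 h2
    rcases h2.lt_or_eq with h2 | rfl
    · have hfl : ⌊t⌋₊ = i := (Nat.floor_eq_iff ((Nat.cast_nonneg i).trans h1)).2 ⟨h1, h2⟩
      have hfr : Int.fract t = t - i := by
        rw [Int.fract_eq_iff]
        exact ⟨by linarith, by linarith, i, by simp⟩
      simp only [γ, hfl, hfr]
    · have := congrArg Subtype.val (hnat (i + 1))
      push_cast at this
      rw [this]
      simp [vertex]
  have hon : ∀ (i : ℕ) (t : ℝ), (i : ℝ) ≤ t → t ≤ i + 1 → (γ t).LiesOn (p i) (p (i + 1)) := by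
    intro i t h1 h2
    refine ⟨hp i, fun w hw => ?_⟩
    by_contra! hne
    apply hw
    simp [coord, hγ i t h1 h2, hne.1.symm, hne.2.symm]
  have hunit : ∀ (i : ℕ) (s t : ℝ), (i : ℝ) ≤ s → s ≤ t → t ≤ i + 1 →
      EDist.edist (γ s) (γ t) ≤ ENNReal.ofReal (t - s) := by
    intro i s t h1 h2 h3
    refine (pathDist_le_edge (hon i s h1 (h2.trans h3)) (hon i t (h1.trans h2) h3)).trans ?_
    apply ENNReal.ofReal_le_ofReal
    rw [coord, coord, hγ i s h1 (h2.trans h3), hγ i t (h1.trans h2) h3]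
    simp only [Finsupp.add_apply, Finsupp.single_apply, if_true]
    split_ifs <;> rw [abs_le] <;> constructor <;> linarith
  have hind : ∀ (n : ℕ) (s t : ℝ), 0 ≤ s → s ≤ t → t ≤ n →
      EDist.edist (γ s) (γ t) ≤ ENNReal.ofReal (t - s) := by
    intro n
    induction n with
    | zero =>
      intro s t h1 h2 h3
      exact hunit 0 s t (by simpa using h1) h2 (by simp at h3 ⊢; linarith)
    | succ n ih =>
      intro s t h1 h2 h3
      push_cast at h3
      rcases le_total t n with h | h
      · exact ih s t h1 h2 h
      rcases le_total (n : ℝ) s with h' | h'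
      · exact hunit n s t h' h2 h3
      calc EDist.edist (γ s) (γ t) ≤ EDist.edist (γ s) (γ n) + EDist.edist (γ n) (γ t) :=
            PseudoEMetricSpace.edist_triangle _ _ _
        _ ≤ ENNReal.ofReal (n - s) + ENNReal.ofReal (t - n) :=
            add_le_add (ih s n h1 h' le_rfl) (hunit n n t le_rfl h h3)
        _ = ENNReal.ofReal (t - s) := by
            rw [← ENNReal.ofReal_add (by linarith) (by linarith)]
            congr 1
            ring
  exact ⟨γ, hnat, fun s t h1 h2 => hind ⌈t⌉₊ s t h1 h2 (Nat.le_ceil t)⟩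

/-- A shortest walk, run along at unit speed, is a geodesic between its ends. -/
lemma exists_isGeodesicSegment (hG : G.Connected) (a b : V) :
    ∃ A, IsGeodesicSegment A (vertex G a) (vertex G b) := by
  obtain ⟨p, hp⟩ := hG.exists_walk_length_eq_edist a b
  obtain ⟨γ, hnat, hγ⟩ := exists_lipschitz_path (G := G) p.getVert (fun i => by
    rcases lt_or_ge i p.length with hi | hi
    · exact Or.inr (p.adj_getVert_succ hi)
    · exact Or.inl (by rw [p.getVert_of_length_le hi, p.getVert_of_length_le (by omega)]))
  have h0 : γ 0 = vertex G a := by simpa using hnat 0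
  have h1 : γ p.length = vertex G b := by simpa using hnat p.length
  have := isGeodesicSegment_of_le (L := p.length) (Nat.cast_nonneg _)
    (fun s t h1 h2 _ => hγ s t h1 h2) (by rw [h0, h1, edist_vertex, ← hp]; simp)
  rw [h0, h1] at this
  exact ⟨_, this⟩

end MetricGraph

lemma edist_vertexSpace (a b : G.VertexSpace) :
    EDist.edist a b = (G.edist (V := V) a b : ℝ≥0∞) :=
  MetricGraph.edist_vertex a b

/-- For a connected graph, hyperbolicity can be read off from the distances between vertices. -/
lemma Connected.isGromovHyperbolic_iff (hG : G.Connected) :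
    IsGromovHyperbolic G.MetricGraph ↔ IsFourPointHyperbolic G.VertexSpace := by
  let _ : PseudoMetricSpace G.MetricGraph :=
    PseudoEMetricSpace.toPseudoMetricSpace (MetricGraph.edist_ne_top hG)
  constructor
  · intro h
    exact IsGromovHyperbolic.isFourPointHyperbolic (Y := G.VertexSpace)
      (f := MetricGraph.vertex G) h (fun _ _ => rfl) (MetricGraph.exists_isGeodesicSegment hG)
  · intro h
    choose f hf using MetricGraph.exists_edist_vertex_le_one (G := G)
    refine IsFourPointHyperbolic.isGromovHyperbolic
      (h.of_roughIsometry (Y := G.VertexSpace) f 2 (fun x y => ?_) fun x y => ?_)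
    · change EDist.edist x y ≤
        EDist.edist (MetricGraph.vertex G (f x)) (MetricGraph.vertex G (f y)) + 2
      refine (edist_triangle4 x (MetricGraph.vertex G (f x)) (MetricGraph.vertex G (f y)) y).trans ?_
      calc _ ≤ 1 + EDist.edist (MetricGraph.vertex G (f x)) (MetricGraph.vertex G (f y)) + 1 :=
            add_le_add (add_le_add (by rw [PseudoEMetricSpace.edist_comm]; exact hf x) le_rfl) (hf y)
        _ = _ := by ring
    · change EDist.edist (MetricGraph.vertex G (f x)) (MetricGraph.vertex G (f y)) ≤
        EDist.edist x y + 2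
      refine (edist_triangle4 _ x y _).trans ?_
      calc _ ≤ 1 + EDist.edist x y + 1 :=
            add_le_add (add_le_add (hf x) le_rfl) (by rw [PseudoEMetricSpace.edist_comm]; exact hf y)
        _ = _ := by ring

/-- The metric graph of a graph without edges is a discrete space with infinite distances, in which
every geodesic is a point. -/
lemma isGromovHyperbolic_of_forall_not_adj (h : ∀ a b, ¬ G.Adj a b) :
    IsGromovHyperbolic G.MetricGraph := by
  have hzero : ∀ x y : G.MetricGraph, EDist.edist x y ≠ ⊤ → EDist.edist x y = 0 := by
    intro x y hxy
    have hvert : ∀ x : G.MetricGraph, ∃ a, x = MetricGraph.vertex G a := by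
      rintro ⟨x, a, b, hab, t, ht, rfl⟩
      obtain rfl := hab.resolve_right (h a b)
      exact ⟨a, Subtype.ext (by simp [MetricGraph.vertex])⟩
    obtain ⟨a, rfl⟩ := hvert x
    obtain ⟨b, rfl⟩ := hvert y
    rw [MetricGraph.edist_vertex] at hxy
    obtain ⟨p⟩ := edist_ne_top_iff_reachable.1 (show G.edist a b ≠ ⊤ by simpa using hxy)
    cases p with
    | nil => simp
    | cons hadj _ => exact absurd hadj (h _ _)
  have side : ∀ {x y z : G.MetricGraph} {A B C : Set G.MetricGraph}, IsGeodesicSegment A x y →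
      IsGeodesicSegment B y z → IsInNeighborhood 0 A (B ∪ C) := by
    rintro x y z A B C ⟨L, γ, hL, rfl, rfl, hd, rfl⟩ ⟨M, η, hM, h0, -, -, rfl⟩ _ ⟨t, ht, rfl⟩
    refine ⟨η 0, Or.inl ⟨0, ⟨le_rfl, hM⟩, rfl⟩, ?_⟩
    rw [h0, hzero _ _ (by rw [hd t ht L ⟨hL, le_rfl⟩]; exact ENNReal.ofReal_ne_top)]
    simp
  exact ⟨0, fun x y z A B C hA hB hC => ⟨side hA hB, side hB hC, side hC hA⟩⟩

lemma ediam_ne_top_of_isBoundedSpace (h : IsBoundedSpace G.MetricGraph) : G.ediam ≠ ⊤ := by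
  intro htop
  obtain ⟨n, hn⟩ := ENNReal.exists_nat_gt h
  obtain ⟨a, b, hab⟩ := ediam_eq_top.1 htop n (ENat.natCast_lt_top n)
  have h1 : (G.edist a b : ℝ≥0∞) ≤ Metric.ediam (Set.univ : Set G.MetricGraph) := by
    rw [← MetricGraph.edist_vertex]
    exact Metric.edist_le_ediam_of_mem (Set.mem_univ _) (Set.mem_univ _)
  have h2 : ((n : ℕ∞) : ℝ≥0∞) < G.edist a b := ENat.toENNReal_lt.2 hab
  exact absurd (h2.trans_le h1) (by simpa using hn.le)

/-! ### Walks in direct products -/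

/-- Two walks of the same length, walked simultaneously, make a walk in the direct product. -/
lemma exists_walk_directProd {a a' : V} {b b' : W} (p : G.Walk a a') (q : H.Walk b b')
    (h : p.length = q.length) :
    ∃ r : (G.directProd H).Walk (a, b) (a', b'), r.length = p.length := by
  induction p generalizing b with
  | nil =>
    cases q with
    | nil => exact ⟨.nil, rfl⟩
    | cons _ _ => simp at h
  | cons hp p ih =>
    cases q with
    | nil => simp at h
    | cons hq q =>
      obtain ⟨r, hr⟩ := ih q (by simpa using h)
      exact ⟨.cons (show (G.directProd H).Adj _ _ from ⟨hp, hq⟩) r, congrArg (· + 1) hr⟩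

lemma edist_fst_le_edist_directProd (x y : V × W) :
    G.edist x.1 y.1 ≤ (G.directProd H).edist x y := by
  by_cases h : (G.directProd H).edist x y = ⊤
  · simp [h]
  obtain ⟨p, hp⟩ := exists_walk_of_edist_ne_top h
  let f : G.directProd H →g G := ⟨Prod.fst, fun h => h.1⟩
  have := edist_le (p.map f)
  rw [Walk.length_map, hp] at this
  exact this

/-- Going back and forth along an edge lengthens a walk by any even number. -/
lemma Walk.exists_length_eq_add_two_mul {a b c : V} (p : G.Walk a b) (h : G.Adj a c) (k : ℕ) :
    ∃ q : G.Walk a b, q.length = p.length + 2 * k := by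
  induction k with
  | zero => exact ⟨p, rfl⟩
  | succ k ih =>
    obtain ⟨q, hq⟩ := ih
    exact ⟨.cons h (.cons h.symm q), by simp [hq]; ring⟩

lemma exists_walk_length_eq (h : ∀ a, ∃ b, G.Adj a b) (a : V) (n : ℕ) :
    ∃ b, ∃ p : G.Walk a b, p.length = n := by
  induction n generalizing a with
  | zero => exact ⟨a, .nil, rfl⟩
  | succ n ih =>
    obtain ⟨c, hc⟩ := h a
    obtain ⟨b, p, hp⟩ := ih c
    exact ⟨b, .cons hc p, by simp [hp]⟩

/-- If `b` lies on an odd closed walk of length `g` of the second factor, distances in the first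
factor do not grow by more than `g` in the slice through `b`. A shortest walk of even length `k` is
paired with a walk back and forth along an edge at `b`; if `k` is odd, the odd closed walk corrects
the parity, after which the shorter of the two walks is lengthened. -/
lemma edist_slice_le (hG : G.Connected) {g : ℕ} {b : W} (c : H.Walk b b) (hc : c.length = g)
    (hodd : Odd g) (a a' : V) :
    (G.directProd H).edist (a, b) (a', b) ≤ G.edist a a' + g := by
  obtain ⟨p, hp⟩ := hG.exists_walk_length_eq_edist a a'
  obtain ⟨d, hd⟩ : ∃ d, H.Adj b d := by
    cases c with
    | nil => subst hc; simp at hodd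
    | cons h _ => exact ⟨_, h⟩
  rw [← hp]
  have key : ∃ (p' : G.Walk a a') (q : H.Walk b b), p'.length = q.length ∧
      p'.length ≤ p.length + g := by
    rcases Nat.even_or_odd p.length with he | ho
    · obtain ⟨k, hk⟩ := he
      obtain ⟨q, hq⟩ := (Walk.nil (G := H) (u := b)).exists_length_eq_add_two_mul hd k
      exact ⟨p, q, by simp at hq; omega, by omega⟩
    rcases le_total g p.length with hle | hle
    · obtain ⟨k, hk⟩ := Nat.Odd.sub_odd ho hodd
      obtain ⟨q, hq⟩ := c.exists_length_eq_add_two_mul hd k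
      exact ⟨p, q, by omega, by omega⟩
    · obtain ⟨k, hk⟩ := Nat.Odd.sub_odd hodd ho
      obtain ⟨e, he⟩ : ∃ e, G.Adj a e := by
        cases p with
        | nil => simp at ho
        | cons h _ => exact ⟨_, h⟩
      obtain ⟨p', hp'⟩ := p.exists_length_eq_add_two_mul he k
      exact ⟨p', c, by omega, by omega⟩
  obtain ⟨p', q, hlen, hle⟩ := key
  obtain ⟨r, hr⟩ := exists_walk_directProd p' q hlen
  refine (edist_le r).trans ?_
  rw [hr]
  exact_mod_cast hle

/-- The slice through `b₀` is within the diameter of the second factor of every vertex `x`: a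
shortest walk from `x.2` to `b₀` is paired with any walk of the same length from `x.1`. -/
lemma exists_edist_slice_le (hG : ∀ a, ∃ b, G.Adj a b) (hH : H.Connected) (hd : H.ediam ≠ ⊤)
    (b₀ : W) (x : V × W) : ∃ a, (G.directProd H).edist (a, b₀) x ≤ H.diam := by
  obtain ⟨q, hq⟩ := hH.exists_walk_length_eq_dist x.2 b₀
  obtain ⟨a, p, hp⟩ := exists_walk_length_eq hG x.1 q.length
  obtain ⟨r, hr⟩ := exists_walk_directProd p q hp
  refine ⟨a, ?_⟩
  rw [SimpleGraph.edist_comm]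
  refine (edist_le r).trans ?_
  rw [hr, hp, hq]
  exact_mod_cast dist_le_diam hd

/-- The projection of a direct product to its first factor is a rough isometry, if the second factor
is bounded and has an odd closed walk. -/
lemma edist_directProd_le (hG : G.Connected) (hadj : ∀ a, ∃ b, G.Adj a b) (hH : H.Connected)
    (hd : H.ediam ≠ ⊤) {g : ℕ} {b₀ : W} (c : H.Walk b₀ b₀) (hc : c.length = g) (hodd : Odd g)
    (x y : V × W) :
    (G.directProd H).edist x y ≤ G.edist x.1 y.1 + (4 * H.diam + g : ℕ) := by
  obtain ⟨a, ha⟩ := exists_edist_slice_le hadj hH hd b₀ x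
  obtain ⟨b, hb⟩ := exists_edist_slice_le hadj hH hd b₀ y
  have ha' := (edist_fst_le_edist_directProd (G := G) (H := H) (a, b₀) x).trans ha
  have hb' := (edist_fst_le_edist_directProd (G := G) (H := H) (b, b₀) y).trans hb
  have hab : G.edist a b ≤ H.diam + G.edist x.1 y.1 + H.diam :=
    calc G.edist a b ≤ G.edist a x.1 + G.edist x.1 y.1 + G.edist y.1 b :=
          SimpleGraph.edist_triangle.trans (add_le_add SimpleGraph.edist_triangle le_rfl)
      _ ≤ _ := add_le_add (add_le_add ha' le_rfl) (by rw [SimpleGraph.edist_comm]; exact hb')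
  calc (G.directProd H).edist x y
      ≤ (G.directProd H).edist x (a, b₀) + (G.directProd H).edist (a, b₀) (b, b₀) +
          (G.directProd H).edist (b, b₀) y :=
        SimpleGraph.edist_triangle.trans (add_le_add SimpleGraph.edist_triangle le_rfl)
    _ ≤ H.diam + ((H.diam + G.edist x.1 y.1 + H.diam) + g) + H.diam :=
        add_le_add (add_le_add (by rw [SimpleGraph.edist_comm]; exact ha)
          ((edist_slice_le hG c hc hodd a b).trans (add_le_add hab le_rfl))) hb
    _ = _ := by push_cast; ring

/-! ### The slice map and the projection -/

lemma edist_sliceMap (b : W) (x y : G.VertexSpace) :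
    EDist.edist (sliceMap G H b x) (sliceMap G H b y) =
      ((G.directProd H).edist ((x, b) : V × W) ((y, b) : V × W) : ℝ≥0∞) :=
  edist_vertexSpace (G := G.directProd H) _ _

lemma edist_le_edist_sliceMap (b : W) (x y : G.VertexSpace) :
    EDist.edist x y ≤ EDist.edist (sliceMap G H b x) (sliceMap G H b y) := by
  rw [edist_sliceMap, edist_vertexSpace]
  exact ENat.toENNReal_le.2 (edist_fst_le_edist_directProd (H := H) (_, b) (_, b))

lemma edist_sliceMap_le (hG : G.Connected) {g : ℕ} {b : W} (c : H.Walk b b) (hc : c.length = g)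
    (hodd : Odd g) (x y : G.VertexSpace) :
    EDist.edist (sliceMap G H b x) (sliceMap G H b y) ≤ EDist.edist x y + (g : ℝ≥0) := by
  rw [edist_sliceMap, edist_vertexSpace]
  refine (ENat.toENNReal_le.2 (edist_slice_le hG c hc hodd _ _)).trans (le_of_eq ?_)
  simp

/-- The projection of the vertices of a direct product to those of its first factor. -/
def fstMap (G : SimpleGraph V) (H : SimpleGraph W) : (G.directProd H).VertexSpace → G.VertexSpace :=
  (Prod.fst : V × W → V)

lemma edist_fstMap_le (x y : (G.directProd H).VertexSpace) :
    EDist.edist (fstMap G H x) (fstMap G H y) ≤ EDist.edist x y := by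
  rw [edist_vertexSpace, edist_vertexSpace]
  exact ENat.toENNReal_le.2 (edist_fst_le_edist_directProd _ _)

end SimpleGraph

open SimpleGraph in
theorem mainTheorem2 {V₁ V₂ : Type*} (G₁ : SimpleGraph V₁) (G₂ : SimpleGraph V₂)
    (hG₁ : G₁.Connected) (hG₂ : G₂.Connected) (hnt : Nontrivial V₂)
    (hbdd : IsBoundedSpace G₂.MetricGraph) (hodd : G₂.HasOddCycle) :
    (IsGromovHyperbolic (G₁.directProd G₂).MetricGraph ↔ IsGromovHyperbolic G₁.MetricGraph) ∧
    (Nontrivial V₁ → ∀ v₀ : V₂, G₂.IsOddCycleLengthAt v₀ G₂.oddGirth →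
      IsQuasiIsometricEmbedding 1 (G₂.oddGirth : NNReal) (SimpleGraph.sliceMap G₁ G₂ v₀) ∧
      IsFull ((G₂.diam : NNReal) + (G₂.oddGirth : NNReal)) (SimpleGraph.sliceMap G₁ G₂ v₀)) := by
  have hd := ediam_ne_top_of_isBoundedSpace hbdd
  refine ⟨?_, fun hnt₁ v₀ ⟨c, _, hc, hcg⟩ => ⟨⟨le_rfl, fun x y => ⟨?_, ?_⟩⟩, fun y => ?_⟩⟩
  · rcases subsingleton_or_nontrivial V₁ with hs | hnt₁
    · have h₁ : ∀ a b, ¬ G₁.Adj a b := fun a b h => h.ne (Subsingleton.elim a b)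
      exact iff_of_true (isGromovHyperbolic_of_forall_not_adj fun a b h => h₁ _ _ h.1)
        (isGromovHyperbolic_of_forall_not_adj h₁)
    obtain ⟨v₀, n, c, _, hc, rfl⟩ := hodd
    have hadj := hG₁.preconnected.exists_adj_of_nontrivial
    have hle := edist_directProd_le hG₁ hadj hG₂ hd c rfl hc
    have hconn : (G₁.directProd G₂).Connected := by
      have := hG₁.nonempty
      have := hG₂.nonempty
      refine ⟨fun x y => edist_ne_top_iff_reachable.1 (ne_top_of_le_ne_top ?_ (hle x y))⟩
      have := edist_ne_top_iff_reachable.2 (hG₁ x.1 y.1)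
      exact WithTop.add_ne_top.2 ⟨this, ENat.natCast_ne_top _⟩
    rw [hconn.isGromovHyperbolic_iff, hG₁.isGromovHyperbolic_iff]
    constructor
    · intro h
      exact h.of_roughIsometry (sliceMap G₁ G₂ v₀) c.length
        (fun x y => (edist_le_edist_sliceMap v₀ x y).trans le_self_add)
        (edist_sliceMap_le hG₁ c rfl hc)
    · intro h
      refine h.of_roughIsometry (fstMap G₁ G₂) ((4 * G₂.diam + c.length : ℕ) : ℝ≥0)
        (fun x y => ?_) fun x y => (edist_fstMap_le x y).trans le_self_add
      rw [edist_vertexSpace, edist_vertexSpace]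
      refine (ENat.toENNReal_le.2 (hle _ _)).trans (le_of_eq ?_)
      rw [ENat.toENNReal_add]
      rfl
  · simpa using edist_le_edist_sliceMap v₀ x y |>.trans le_self_add
  · simpa using edist_sliceMap_le hG₁ c hcg (hcg ▸ hc) x y
  · obtain ⟨x, hx⟩ := exists_edist_slice_le hG₁.preconnected.exists_adj_of_nontrivial hG₂ hd v₀ y
    refine ⟨x, (edist_vertexSpace _ _).trans_le ((ENat.toENNReal_le.2 hx).trans ?_)⟩
    simp
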